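/- Let $\zeta$ be the (analytically continued) Riemann zeta-function and let $B_n$ be the Bernoulli numbers, $\frac{Z}{e^Z-1}=\sum_{n\ge0}\frac{B_n}{n!}Z^n$. For an integer $r$ and a complex number $q$ with $|q|<1$ put $$\mathcal S_r(q)=\sum_{k=1}^\infty\sum_{l=1}^\infty\frac{q^{kl}}{l^r},$$ where the double series converges absolutely for the values of $q$ below. (i) For any integer $k\ge1$, $$\zeta(2k)=\frac{(-1)^{k+1}(2\pi)^{2k}}{2\,(2k)!}B_{2k}.$$ (ii) Let $\tau\in\mathbb C\setminus\{0\}$ with $|\arg\tau|<\pi/2$, and put $q=e^{-2\pi\tau}$ and $\hat q=e^{-2\pi/\tau}$. Then for any integer $k\ne0$ (positive or negative), $$\zeta(2k+1)+2\mathcal S_{2k+1}(q)+(2\pi)^{2k+1}\sum_{j=0}^{k+1}\frac{(-1)^jB_{2j}B_{2k+2-2j}}{(2j)!\,(2k+2-2j)!}\tau^{2k+1-2j}=(-1)^k\tau^{2k}\bigl\{\zeta(2k+1)+2\mathcal S_{2k+1}(\hat q)\bigr\},$$ where the sum over $j$ is empty if $k<-1$. -/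

import Mathlib

/-- The general term `q ^ (k l) / l ^ r` of the `q`-series `S_r(q)`, indexed by pairs `(k, l)` of
positive integers. -/
noncomputable def qSeriesTerm (r : ℤ) (q : ℂ) (p : ℕ+ × ℕ+) : ℂ :=
  q ^ ((p.1 : ℕ) * (p.2 : ℕ)) / ((p.2 : ℕ) : ℂ) ^ r

/-- The `q`-series `S_r(q) = S_r(0,0;0,0;q) = ∑_{k, l ≥ 1} q ^ (k l) / l ^ r`. -/
noncomputable def qSeries (r : ℤ) (q : ℂ) : ℂ :=
  ∑' p : ℕ+ × ℕ+, qSeriesTerm r q p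

/-!
Put `L_r(τ) = ζ(r) + 2 S_r(e ^ (-2πτ))`. For `r = 1 - 2m < 0` this is, up to a constant factor, the
Eisenstein series of weight `2m` at `iτ`, and `τ ↦ 1 / τ` becomes `z ↦ -1 / z`; modularity gives the
formula, the quasi-modularity of `E₂` being the source of the term with `k = -1`. For `r > 1`,
`L_r(τ) = ∑ coth (π l τ) / l ^ r`, and the partial fractions of `coth` turn this into a sum over
pairs `(l, n)` of `1 / (l ^ (r - 1) ((l τ) ^ 2 + n ^ 2))`. Exchanging `l` and `n` and replacing `τ`
by `1 / τ` changes each term by a finite geometric sum in `l ^ 2 τ ^ 2` and `n ^ 2`, whose total is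
a combination of products of even zeta values, that is, by Euler, of Bernoulli numbers.
-/

open Complex EisensteinSeries Finset
open UpperHalfPlane hiding I
open scoped Real Nat ModularForm ArithmeticFunction.sigma

theorem inv_re_pos {τ : ℂ} (hτ : 0 < τ.re) : 0 < (τ⁻¹).re := by
  rw [inv_re]
  exact div_pos hτ (normSq_pos.mpr (ne_zero_of_re_pos hτ))

theorem norm_exp_neg_two_mul_lt_one {z : ℂ} (hz : 0 < z.re) : ‖cexp (-2 * z)‖ < 1 := by
  rw [norm_exp, Real.exp_lt_one_iff]
  simpa using hz

theorem norm_exp_neg_two_pi_mul_lt_one {τ : ℂ} (hτ : 0 < τ.re) :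
    ‖cexp (-2 * π * τ)‖ < 1 := by
  rw [mul_assoc]
  exact norm_exp_neg_two_mul_lt_one (by simpa using mul_pos Real.pi_pos hτ)

section QSeries

variable {q : ℂ}

theorem summable_qSeriesTerm (r : ℤ) (hq : ‖q‖ < 1) : Summable (qSeriesTerm r q) := by
  refine Summable.of_norm_bounded
    (summable_prod_mul_pow (𝕜 := ℝ) r.natAbs (r := ‖q‖) (by simpa using hq)) fun p ↦ ?_
  have hl : (1 : ℝ) ≤ (p.2 : ℕ) := by exact_mod_cast p.2.pos
  rw [qSeriesTerm, norm_div, norm_pow, norm_zpow, norm_natCast, div_eq_mul_inv, mul_comm,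
    ← zpow_neg, ← zpow_natCast (p.2 : ℝ)]
  gcongr
  omega

theorem hasSum_qSeries_fiberwise (r : ℤ) (hq : ‖q‖ < 1) :
    HasSum (fun l : ℕ+ ↦ ((l : ℂ) ^ r)⁻¹ * ∑' k : ℕ+, (q ^ (l : ℕ)) ^ (k : ℕ)) (qSeries r q) := by
  have hs := (Equiv.prodComm ℕ+ ℕ+).summable_iff.mpr (summable_qSeriesTerm r hq)
  have hsum := ((Equiv.prodComm ℕ+ ℕ+).hasSum_iff.mpr (summable_qSeriesTerm r hq).hasSum)
  refine hsum.prod_fiberwise fun l ↦ ?_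
  convert! (hs.prod_factor l).hasSum using 1
  rw [← tsum_mul_left]
  refine tsum_congr fun k ↦ ?_
  simp only [Function.comp_apply, Equiv.prodComm_apply, Prod.swap_prod_mk, qSeriesTerm, ← pow_mul,
    mul_comm (k : ℕ), div_eq_inv_mul]

theorem qSeries_neg_natCast (m : ℕ) (hq : ‖q‖ < 1) :
    qSeries (-m) q = ∑' n : ℕ+, (σ m n : ℂ) * q ^ (n : ℕ) := by
  rw [← tsum_prod_pow_eq_tsum_sigma m hq, ← (summable_prod_mul_pow m hq).tsum_prod, qSeries]
  refine tsum_congr fun p ↦ ?_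
  rw [qSeriesTerm, zpow_neg, zpow_natCast, div_inv_eq_mul, mul_comm]

end QSeries

/-- The function `ζ(r) + 2 S_r(e ^ (-2πτ))` related by Ramanujan's formula at `τ` and `1 / τ`. For
`r > 1` it is the sum of `coth (π l τ) / l ^ r` over `l ≥ 1`, whence the name; for negative odd `r`
it is `ζ(r)` times the Eisenstein series of weight `1 - r` at `i τ`. -/
noncomputable def cothSeries (r : ℤ) (τ : ℂ) : ℂ :=
  riemannZeta r + 2 * qSeries r (cexp (-2 * π * τ))

section Eisenstein

theorem bernoulli_ne_zero_of_even {n : ℕ} (hn : Even n) : bernoulli n ≠ 0 := by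
  obtain ⟨m, rfl⟩ := hn.exists_two_nsmul
  rw [smul_eq_mul]
  rcases eq_or_ne m 0 with rfl | hm
  · simp
  intro hB
  have hζ : riemannZeta (2 * m) = 0 := by simp [riemannZeta_two_mul_nat hm, hB]
  refine riemannZeta_ne_zero_of_one_lt_re ?_ hζ
  have : (1 : ℝ) ≤ m := by exact_mod_cast Nat.one_le_iff_ne_zero.mpr hm
  simp only [mul_re, re_ofNat, natCast_re, im_ofNat, natCast_im, mul_zero, sub_zero]
  linarith

theorem E_S_smul {k : ℕ} (hk : 3 ≤ k) (z : ℍ) :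
    ModularForm.E hk (ModularGroup.S • z) = (z : ℂ) ^ k * ModularForm.E hk z := by
  have h : (⇑(ModularForm.E hk) ∣[(k : ℤ)] ModularGroup.S) z = ModularForm.E hk z :=
    congr_fun (SlashInvariantForm.slash_action_eqn (ModularForm.E hk)
      (Matrix.SpecialLinearGroup.mapGL ℝ ModularGroup.S) ⟨_, rfl⟩) z
  rw [SlashInvariantForm.slash_S_apply, ← modular_S_smul, zpow_neg, zpow_natCast] at h
  rw [← h, mul_comm, inv_mul_cancel_right₀ (pow_ne_zero k z.ne_zero)]

theorem E2_S_smul (z : ℍ) :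
    E2 (ModularGroup.S • z) = (z : ℂ) ^ 2 * E2 z - 6 * I * z / π := by
  have hz : (z : ℂ) ≠ 0 := z.ne_zero
  simp only [E2, Pi.smul_apply, smul_eq_mul, G2_S_transform z, riemannZeta_two]
  field_simp
  ring

/-- The quarter turn `τ ↦ i τ` from the right half-plane to the upper half-plane, which carries
`τ ↦ 1 / τ` to the action of `S`. -/
noncomputable def quarterTurn (τ : ℂ) (hτ : 0 < τ.re) : ℍ := ⟨I * τ, by simpa using hτ⟩

variable {τ : ℂ}

theorem coe_quarterTurn (hτ : 0 < τ.re) : (quarterTurn τ hτ : ℂ) = I * τ := rfl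

theorem S_smul_quarterTurn (hτ : 0 < τ.re) :
    ModularGroup.S • quarterTurn τ hτ = quarterTurn τ⁻¹ (inv_re_pos hτ) := by
  rw [modular_S_smul, UpperHalfPlane.ext_iff]
  simp [coe_quarterTurn, mul_comm]

theorem cothSeries_neg_natCast (hτ : 0 < τ.re) (m : ℕ) :
    cothSeries (-m) τ =
      riemannZeta (-m) + 2 * ∑' n : ℕ+, σ m n * cexp (2 * π * I * quarterTurn τ hτ) ^ (n : ℕ) := by
  have hexp : 2 * π * I * quarterTurn τ hτ = -2 * π * τ := by
    rw [coe_quarterTurn]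
    linear_combination (2 * (π : ℂ) * τ) * I_sq
  rw [cothSeries, hexp, qSeries_neg_natCast m (norm_exp_neg_two_pi_mul_lt_one hτ)]
  push_cast
  rfl

theorem riemannZeta_neg_one : riemannZeta (-1) = -1 / 12 := by
  have h := riemannZeta_neg_nat_eq_bernoulli 1
  rw [Nat.cast_one] at h
  rw [h, one_add_one_eq_two, bernoulli_two]
  norm_num

theorem cothSeries_neg_one (hτ : 0 < τ.re) :
    cothSeries (-1) τ = riemannZeta (-1) * E2 (quarterTurn τ hτ) := by
  have h := cothSeries_neg_natCast hτ 1
  rw [Nat.cast_one, Nat.cast_one] at h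
  rw [h, E2_eq_tsum_cexp, riemannZeta_neg_one]
  ring

theorem cothSeries_neg_natCast_of_even (hτ : 0 < τ.re) {m : ℕ} (hm : 3 ≤ m + 1)
    (hm' : Even (m + 1)) :
    cothSeries (-m) τ = riemannZeta (-m) * ModularForm.E hm (quarterTurn τ hτ) := by
  have hodd : Odd m := by rwa [Nat.even_add_one, Nat.not_even_iff_odd] at hm'
  have hζ : riemannZeta (-m) = -(bernoulli (m + 1) / (m + 1 : ℕ)) := by
    rw [riemannZeta_neg_nat_eq_bernoulli, hodd.neg_one_pow, neg_one_mul, neg_div]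
    push_cast
    rfl
  have hB : (bernoulli (m + 1) : ℂ) ≠ 0 := by exact_mod_cast bernoulli_ne_zero_of_even hm'
  have hm0 : ((m + 1 : ℕ) : ℂ) ≠ 0 := by exact_mod_cast m.succ_ne_zero
  rw [cothSeries_neg_natCast hτ, q_expansion_bernoulli hm hm', hζ, Nat.add_sub_cancel]
  simp only [zpow_natCast]
  field_simp
  ring

theorem cothSeries_neg_one_inv (hτ : 0 < τ.re) :
    cothSeries (-1) τ⁻¹ = -τ ^ 2 * cothSeries (-1) τ - τ / (2 * π) := by
  rw [cothSeries_neg_one (inv_re_pos hτ), ← S_smul_quarterTurn hτ, E2_S_smul,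
    cothSeries_neg_one hτ, coe_quarterTurn, riemannZeta_neg_one, mul_pow]
  linear_combination (τ / (2 * π) - τ ^ 2 * E2 (quarterTurn τ hτ) / 12) * I_sq

theorem cothSeries_neg_natCast_inv (hτ : 0 < τ.re) {m : ℕ} (hm : 3 ≤ m + 1)
    (hm' : Even (m + 1)) :
    cothSeries (-m) τ⁻¹ = (I * τ) ^ (m + 1) * cothSeries (-m) τ := by
  rw [cothSeries_neg_natCast_of_even (inv_re_pos hτ) hm hm', ← S_smul_quarterTurn hτ, E_S_smul,
    cothSeries_neg_natCast_of_even hτ hm hm', coe_quarterTurn]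
  ring

end Eisenstein

section Hyperbolic

theorem one_add_tsum_pnat_pow {q : ℂ} (hq : ‖q‖ < 1) :
    1 + ∑' n : ℕ+, q ^ (n : ℕ) = (1 - q)⁻¹ := by
  rw [← tsum_geometric_of_norm_lt_one hq,
    ← tsum_zero_pnat_eq_tsum_nat (f := fun n ↦ q ^ n) (summable_geometric_of_norm_lt_one hq),
    pow_zero]

theorem cosh_div_sinh_eq_one_add_two_mul_tsum {z : ℂ} (hz : 0 < z.re) :
    cosh z / sinh z = 1 + 2 * ∑' n : ℕ+, cexp (-2 * z) ^ (n : ℕ) := by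
  have hq := norm_exp_neg_two_mul_lt_one hz
  have hq1 : 1 - cexp (-2 * z) ≠ 0 := by
    refine sub_ne_zero.mpr fun h ↦ ?_
    rw [← h, norm_one] at hq
    exact lt_irrefl _ hq
  have hcosh : cosh z = cexp z * (1 + cexp (-2 * z)) / 2 := by
    rw [cosh, mul_add, mul_one, ← exp_add]
    ring_nf
  have hsinh : sinh z = cexp z * (1 - cexp (-2 * z)) / 2 := by
    rw [sinh, mul_sub, mul_one, ← exp_add]
    ring_nf
  have hz0 : cexp z ≠ 0 := exp_ne_zero z
  rw [eq_sub_of_add_eq' (one_add_tsum_pnat_pow hq), hcosh, hsinh]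
  generalize cexp (-2 * z) = q at hq1
  field_simp
  ring

theorem pi_mul_cosh_div_sinh {τ : ℂ} (hτ : I * τ ∈ integerComplement) :
    π * (cosh (π * τ) / sinh (π * τ)) = τ⁻¹ + 2 * τ * ∑' n : ℕ+, (τ ^ 2 + (n : ℂ) ^ 2)⁻¹ := by
  have hcot : π * cot (π * (I * τ)) = -I * (π * (cosh (π * τ) / sinh (π * τ))) := by
    rw [cot, show π * (I * τ) = π * τ * I by ring, cos_mul_I, sin_mul_I, ← div_div, div_I]
    ring
  have hterm (n : ℕ+) : 1 / (I * τ - n) + 1 / (I * τ + n) =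
      -I * (2 * τ * (τ ^ 2 + (n : ℂ) ^ 2)⁻¹) := by
    have hadd : I * τ + n ≠ 0 := by
      exact_mod_cast integerComplement_add_ne_zero hτ (n : ℤ)
    have hsub : I * τ - n ≠ 0 := by
      simpa [sub_eq_add_neg] using integerComplement_add_ne_zero hτ (-(n : ℤ))
    have hfactor : τ ^ 2 + (n : ℂ) ^ 2 = -((I * τ + n) * (I * τ - n)) := by
      linear_combination τ ^ 2 * I_sq
    rw [hfactor]
    field_simp
    ring
  have h := cot_series_rep hτ
  rw [hcot, tsum_congr hterm, tsum_mul_left, tsum_mul_left, one_div, mul_inv, inv_I, ← mul_add] at h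
  exact mul_left_cancel₀ (neg_ne_zero.mpr I_ne_zero) h

end Hyperbolic

section LatticeSum

variable {τ : ℂ}

theorem hasSum_pnat_inv_pow {k : ℕ} (hk : 1 < k) :
    HasSum (fun n : ℕ+ ↦ ((n : ℂ) ^ k)⁻¹) (riemannZeta k) := by
  have hs : Summable fun n : ℕ ↦ ((n : ℂ) ^ k)⁻¹ :=
    .of_norm (by simpa using Real.summable_nat_pow_inv.mpr hk)
  have h := zeta_nat_eq_tsum_of_gt_one hk
  have h0 : (((0 : ℕ) : ℂ) ^ k)⁻¹ = 0 := by
    rw [Nat.cast_zero, zero_pow (by omega), inv_zero]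
  simp only [one_div] at h
  rw [h, ← tsum_pnat_eq_tsum_of_eq_zero (f := fun n : ℕ ↦ ((n : ℂ) ^ k)⁻¹) h0]
  exact (hs.comp_injective PNat.coe_injective).hasSum

theorem hasSum_mul_of_hasSum {𝕜 ι κ : Type*} [RCLike 𝕜] {f : ι → 𝕜} {g : κ → 𝕜} {a b : 𝕜}
    (hf : HasSum f a) (hg : HasSum g b) : HasSum (fun p : ι × κ ↦ f p.1 * g p.2) (a * b) :=
  hf.mul hg (summable_mul_of_summable_norm hf.summable.norm hg.summable.norm)

theorem hasSum_pnat_inv_pow_mul_inv_pow {a b : ℕ} (ha : 1 < a) (hb : 1 < b) :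
    HasSum (fun p : ℕ+ × ℕ+ ↦ ((p.1 : ℂ) ^ a)⁻¹ * ((p.2 : ℂ) ^ b)⁻¹)
      (riemannZeta a * riemannZeta b) := by
  have h := hasSum_mul_of_hasSum (hasSum_pnat_inv_pow ha) (hasSum_pnat_inv_pow hb)
  exact h

theorem hasSum_cothSeries {r : ℕ} (hr : 1 < r) (hτ : 0 < τ.re) :
    HasSum (fun l : ℕ+ ↦ ((l : ℂ) ^ r)⁻¹ * (cosh (π * (l * τ)) / sinh (π * (l * τ))))
      (cothSeries r τ) := by
  refine ((hasSum_pnat_inv_pow hr).add ((hasSum_qSeries_fiberwise r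
    (norm_exp_neg_two_pi_mul_lt_one hτ)).mul_left 2)).congr_fun fun l ↦ ?_
  have hl : 0 < (π * (l * τ)).re := by
    have : (0 : ℝ) < l := by exact_mod_cast l.pos
    simpa using mul_pos Real.pi_pos (mul_pos this hτ)
  have hexp : cexp (-2 * (π * (l * τ))) = cexp (-2 * π * τ) ^ (l : ℕ) := by
    rw [← exp_nat_mul]
    ring_nf
  rw [cosh_div_sinh_eq_one_add_two_mul_tsum hl, hexp, zpow_natCast]
  ring

theorem exists_mul_sq_le_norm_sq_add_sq (hτ : 0 < τ.re) :
    ∃ c : ℝ, 0 < c ∧ ∀ x y : ℝ, c * y ^ 2 ≤ ‖(x * τ) ^ 2 + (y : ℂ) ^ 2‖ := by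
  let z := quarterTurn τ hτ
  refine ⟨r z * r z, mul_pos (r_pos z) (r_pos z), fun x y ↦ ?_⟩
  rcases eq_or_ne y 0 with rfl | hy
  · simpa using sq_nonneg (|x| * ‖τ‖)
  have hfactor : (x * τ) ^ 2 + (y : ℂ) ^ 2 =
      -(((x / y : ℝ) * z + (1 : ℝ)) * ((x / y : ℝ) * z + (-1 : ℝ))) * y ^ 2 := by
    have : (y : ℂ) ≠ 0 := by exact_mod_cast hy
    simp only [z, coe_quarterTurn]
    push_cast
    field_simp
    linear_combination x ^ 2 * τ ^ 2 * I_sq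
  rw [hfactor, norm_mul, norm_neg, norm_mul, norm_pow, norm_real, Real.norm_eq_abs, sq_abs]
  gcongr
  · exact (r_pos z).le
  · exact auxbound2 z _ (by norm_num)
  · exact auxbound2 z _ (by norm_num)

/-- The term `1 / (l ^ m ((l τ) ^ 2 + n ^ 2))`, indexed by pairs `(l, n)`, of the double series
obtained from `∑ coth (π l τ) / l ^ (m + 1)` by expanding `coth` in partial fractions. -/
noncomputable def latticeTerm (m : ℕ) (τ : ℂ) (p : ℕ+ × ℕ+) : ℂ :=
  ((p.1 : ℂ) ^ m)⁻¹ * ((p.1 * τ) ^ 2 + (p.2 : ℂ) ^ 2)⁻¹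

theorem summable_latticeTerm {m : ℕ} (hm : 1 < m) (hτ : 0 < τ.re) :
    Summable (latticeTerm m τ) := by
  obtain ⟨c, hc, hle⟩ := exists_mul_sq_le_norm_sq_add_sq hτ
  have hs {k : ℕ} (hk : 1 < k) : Summable fun n : ℕ+ ↦ ((n : ℝ) ^ k)⁻¹ :=
    (Real.summable_nat_pow_inv.mpr hk).comp_injective PNat.coe_injective
  refine .of_norm_bounded (((hs hm).mul_of_nonneg (hs one_lt_two) (fun _ ↦ by positivity)
      (fun _ ↦ by positivity)).mul_left c⁻¹) fun p ↦ ?_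
  calc ‖latticeTerm m τ p‖
      = ((p.1 : ℝ) ^ m)⁻¹ * ‖((p.1 : ℝ) * τ) ^ 2 + ((p.2 : ℝ) : ℂ) ^ 2‖⁻¹ := by
        simp [latticeTerm]
    _ ≤ ((p.1 : ℝ) ^ m)⁻¹ * (c * (p.2 : ℝ) ^ 2)⁻¹ := by
        gcongr
        exact hle _ _
    _ = c⁻¹ * (((p.1 : ℝ) ^ m)⁻¹ * ((p.2 : ℝ) ^ 2)⁻¹) := by
        rw [mul_inv]
        ring

theorem cothSeries_eq_tsum_latticeTerm {m : ℕ} (hm : 1 < m) (hτ : 0 < τ.re) :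
    cothSeries (m + 1 : ℕ) τ =
      (π : ℂ)⁻¹ * (riemannZeta (m + 2 : ℕ) * τ⁻¹ + 2 * τ * ∑' p, latticeTerm m τ p) := by
  have hs := summable_latticeTerm hm hτ
  refine (hasSum_cothSeries (by omega) hτ).unique ?_
  refine ((((hasSum_pnat_inv_pow (by omega)).mul_right τ⁻¹).add ((hs.hasSum.prod_fiberwise
    fun l ↦ (hs.prod_factor l).hasSum).mul_left (2 * τ))).mul_left (π : ℂ)⁻¹).congr_fun fun l ↦ ?_
  have hl : 0 < (l * τ).re := by
    have : (0 : ℝ) < l := by exact_mod_cast l.pos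
    simpa using mul_pos this hτ
  have hcoth : cosh (π * (l * τ)) / sinh (π * (l * τ)) = (π : ℂ)⁻¹ *
      ((l * τ)⁻¹ + 2 * (l * τ) * ∑' n : ℕ+, ((l * τ) ^ 2 + (n : ℂ) ^ 2)⁻¹) := by
    rw [eq_inv_mul_iff_mul_eq₀ (by exact_mod_cast Real.pi_ne_zero)]
    exact pi_mul_cosh_div_sinh (quarterTurn _ hl).coe_mem_integerComplement
  have hl0 : (l : ℂ) ≠ 0 := by simp
  simp only [hcoth, latticeTerm, tsum_mul_left]
  field_simp
  ring

theorem sum_antidiagonal_inv_pow_mul_inv_pow {K : Type*} [Field K] {x y t : K} (hx : x ≠ 0)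
    (hy : y ≠ 0) (hxy : x * t + y ≠ 0) (m : ℕ) :
    ∑ p ∈ antidiagonal m, (-t) ^ p.2 * ((x ^ (p.1 + 1))⁻¹ * (y ^ (p.2 + 1))⁻¹) =
      ((x ^ (m + 1))⁻¹ - (-t) ^ (m + 1) * (y ^ (m + 1))⁻¹) * (x * t + y)⁻¹ := by
  have hgeom : (∑ p ∈ antidiagonal m, x⁻¹ ^ p.1 * (-t * y⁻¹) ^ p.2) * (x⁻¹ - -t * y⁻¹) =
      x⁻¹ ^ (m + 1) - (-t * y⁻¹) ^ (m + 1) := by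
    rw [Nat.sum_antidiagonal_eq_sum_range_succ_mk, ← geom_sum₂_mul]
    simp
  have hsub : x⁻¹ - -t * y⁻¹ = (x * t + y) * (x⁻¹ * y⁻¹) := by
    field_simp
    ring
  rw [eq_mul_inv_iff_mul_eq₀ hxy, ← inv_pow, ← inv_pow y, ← mul_pow, ← hgeom, hsub, sum_mul,
    sum_mul]
  refine sum_congr rfl fun p _ ↦ ?_
  rw [mul_pow]
  ring

theorem latticeTerm_add_latticeTerm_inv (m : ℕ) (hτ : 0 < τ.re) (p : ℕ+ × ℕ+) :
    latticeTerm (2 * (m + 1)) τ p + (-τ ^ 2) ^ m * latticeTerm (2 * (m + 1)) τ⁻¹ p.swap =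
      ∑ i ∈ antidiagonal m, (-τ ^ 2) ^ i.2 *
        (((p.1 : ℂ) ^ (2 * (i.1 + 1)))⁻¹ * ((p.2 : ℂ) ^ (2 * (i.2 + 1)))⁻¹) := by
  have hτ0 : τ ≠ 0 := ne_zero_of_re_pos hτ
  have hp (n : ℕ+) : (n : ℂ) ^ 2 ≠ 0 := by simp
  have hne : (p.1 : ℂ) ^ 2 * τ ^ 2 + (p.2 : ℂ) ^ 2 ≠ 0 := by
    obtain ⟨c, hc, hle⟩ := exists_mul_sq_le_norm_sq_add_sq hτ
    have := (by positivity : 0 < c * (p.2 : ℝ) ^ 2).trans_le (hle p.1 p.2)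
    rw [← mul_pow]
    simpa using norm_pos_iff.mp this
  have hswap : ((p.2 : ℂ) * τ⁻¹) ^ 2 + (p.1 : ℂ) ^ 2 =
      ((p.1 : ℂ) ^ 2 * τ ^ 2 + (p.2 : ℂ) ^ 2) * (τ ^ 2)⁻¹ := by
    field_simp
    ring
  simp only [pow_mul, sum_antidiagonal_inv_pow_mul_inv_pow (hp p.1) (hp p.2) hne, latticeTerm,
    Prod.fst_swap, Prod.snd_swap, hswap, mul_pow (p.1 : ℂ) τ, mul_inv, inv_inv]
  ring

theorem tsum_latticeTerm_add_tsum_latticeTerm_inv (m : ℕ) (hτ : 0 < τ.re) :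
    ∑' p, latticeTerm (2 * (m + 1)) τ p + (-τ ^ 2) ^ m * ∑' p, latticeTerm (2 * (m + 1)) τ⁻¹ p =
      ∑ i ∈ antidiagonal m, (-τ ^ 2) ^ i.2 *
        (riemannZeta (2 * (i.1 + 1) : ℕ) * riemannZeta (2 * (i.2 + 1) : ℕ)) := by
  have hsum := (summable_latticeTerm (m := 2 * (m + 1)) (by omega) hτ).hasSum
  have hsum_inv := (Equiv.prodComm ℕ+ ℕ+).hasSum_iff.mpr
    (summable_latticeTerm (m := 2 * (m + 1)) (by omega) (inv_re_pos hτ)).hasSum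
  refine (hsum.add (hsum_inv.mul_left ((-τ ^ 2) ^ m))).unique ?_
  refine (hasSum_sum fun i _ ↦ (hasSum_pnat_inv_pow_mul_inv_pow (a := 2 * (i.1 + 1))
    (b := 2 * (i.2 + 1)) (by omega) (by omega)).mul_left ((-τ ^ 2) ^ i.2)).congr_fun fun p ↦ ?_
  simp only [Function.comp_apply, Equiv.prodComm_apply]
  exact latticeTerm_add_latticeTerm_inv m hτ p

end LatticeSum

section Ramanujan

theorem riemannZeta_two_mul_natCast (k : ℕ) :
    riemannZeta (2 * k) =
      (-1) ^ (k + 1) * (2 * π) ^ (2 * k) / (2 * (2 * k)!) * bernoulli (2 * k) := by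
  have h2 : (2 : ℂ) ^ (2 * k - 1 : ℤ) = 2 ^ (2 * k) / 2 := by
    rw [zpow_sub_one₀ two_ne_zero, div_eq_mul_inv]
    exact_mod_cast rfl
  rw [riemannZeta_two_mul_nat', h2, mul_pow]
  field_simp

theorem two_pi_pow_mul_bernoulli_div_factorial (k : ℕ) :
    (2 * π) ^ (2 * k) * (bernoulli (2 * k) / (2 * k)!) =
      -2 * (-1) ^ k * riemannZeta (2 * k : ℕ) := by
  have hsign : (-1 : ℂ) ^ k * (-1) ^ k = 1 := by rw [← mul_pow, neg_one_mul, neg_neg, one_pow]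
  rw [Nat.cast_mul, Nat.cast_two, riemannZeta_two_mul_natCast, pow_succ]
  linear_combination -(2 * π) ^ (2 * k) * (bernoulli (2 * k) / (2 * k)! : ℂ) * hsign

/-- The Laurent polynomial in `τ` with Bernoulli-number coefficients occurring in Ramanujan's
formula for `ζ(2k + 1)`; it vanishes for `k < -1`. -/
noncomputable def ramanujanPolynomial (k : ℤ) (τ : ℂ) : ℂ :=
  (2 * π) ^ (2 * k + 1) * ∑ j ∈ Icc (0 : ℤ) (k + 1),
    (-1 : ℂ) ^ j * bernoulli (2 * j).toNat * bernoulli (2 * k + 2 - 2 * j).toNat /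
      ((2 * j).toNat ! * (2 * k + 2 - 2 * j).toNat !) * τ ^ (2 * k + 1 - 2 * j)

theorem ramanujanPolynomial_of_lt_neg_one {k : ℤ} (hk : k < -1) (τ : ℂ) :
    ramanujanPolynomial k τ = 0 := by
  rw [ramanujanPolynomial, Icc_eq_empty (by omega), sum_empty, mul_zero]

theorem ramanujanPolynomial_neg_one (τ : ℂ) : ramanujanPolynomial (-1) τ = (2 * π * τ)⁻¹ := by
  simp [ramanujanPolynomial, mul_comm]

theorem sum_Icc_zero_natCast {M : Type*} [AddCommMonoid M] (n : ℕ) (f : ℤ → M) :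
    ∑ j ∈ Icc (0 : ℤ) n, f j = ∑ p ∈ antidiagonal n, f p.1 := by
  refine sum_nbij' (fun j ↦ (j.toNat, n - j.toNat)) (fun p ↦ p.1) ?_ ?_ ?_ ?_ ?_
  all_goals grind [HasAntidiagonal.mem_antidiagonal]

theorem ramanujanPolynomial_natCast (k : ℕ) (τ : ℂ) :
    ramanujanPolynomial k τ = 2 * (π : ℂ)⁻¹ * ∑ p ∈ antidiagonal (k + 1),
      (-1) ^ p.2 * (riemannZeta (2 * p.1 : ℕ) * riemannZeta (2 * p.2 : ℕ)) *
        τ ^ (2 * p.2 - 1 : ℤ) := by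
  rw [ramanujanPolynomial, ← Nat.cast_succ, sum_Icc_zero_natCast, mul_sum, mul_sum]
  refine sum_congr rfl fun ⟨a, b⟩ hab ↦ ?_
  have hk : (k : ℤ) = a + b - 1 := by
    have := HasAntidiagonal.mem_antidiagonal.mp hab
    omega
  have h2π : (2 * π : ℂ) ≠ 0 := by simp [Real.pi_ne_zero]
  have hpow : (2 * π : ℂ) ^ (2 * (k : ℤ) + 1) =
      (2 * π) ^ (2 * a) * (2 * π) ^ (2 * b) * (2 * π : ℂ)⁻¹ := by
    rw [hk, ← pow_add, ← zpow_natCast, ← zpow_sub_one₀ h2π]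
    congr 1
    push_cast
    ring
  have hsign : (-1 : ℂ) ^ a * (-1) ^ a = 1 := by rw [← mul_pow, neg_one_mul, neg_neg, one_pow]
  have ha := two_pi_pow_mul_bernoulli_div_factorial a
  have hb := two_pi_pow_mul_bernoulli_div_factorial b
  rw [hpow, hk, show (2 * (a : ℤ)).toNat = 2 * a by omega,
    show (2 * (a + b - 1 : ℤ) + 2 - 2 * a).toNat = 2 * b by omega,
    show 2 * (a + b - 1 : ℤ) + 1 - 2 * a = 2 * b - 1 by ring, zpow_natCast]
  calc _ = (-1 : ℂ) ^ a * ((2 * π) ^ (2 * a) * (bernoulli (2 * a) / (2 * a)!)) *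
        ((2 * π) ^ (2 * b) * (bernoulli (2 * b) / (2 * b)!)) * (2 * π : ℂ)⁻¹ *
          τ ^ (2 * b - 1 : ℤ) := by ring
    _ = _ := by
      rw [ha, hb, mul_inv]
      linear_combination (2 * (-1) ^ b * riemannZeta (2 * a : ℕ) * riemannZeta (2 * b : ℕ) *
        (π : ℂ)⁻¹ * τ ^ (2 * b - 1 : ℤ)) * hsign

theorem ramanujanPolynomial_natCast_succ (m : ℕ) (τ : ℂ) :
    ramanujanPolynomial (m + 1 : ℕ) τ =
      -(π : ℂ)⁻¹ * (riemannZeta (2 * (m + 2) : ℕ) * (τ⁻¹ + (-τ ^ 2) ^ m * τ ^ 3) +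
        2 * τ * ∑ i ∈ antidiagonal m, (-τ ^ 2) ^ i.2 *
          (riemannZeta (2 * (i.1 + 1) : ℕ) * riemannZeta (2 * (i.2 + 1) : ℕ))) := by
  have hpow (j : ℕ) : τ ^ (2 * (j + 1 : ℕ) - 1 : ℤ) = τ * (τ ^ 2) ^ j := by
    rw [← pow_mul, ← pow_succ', ← zpow_natCast]
    congr 1
    push_cast
    ring
  have hinterior : ∑ i ∈ antidiagonal m, (-1) ^ (i.2 + 1) *
        (riemannZeta (2 * (i.1 + 1) : ℕ) * riemannZeta (2 * (i.2 + 1) : ℕ)) *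
          τ ^ (2 * (i.2 + 1 : ℕ) - 1 : ℤ) =
      -τ * ∑ i ∈ antidiagonal m, (-τ ^ 2) ^ i.2 *
        (riemannZeta (2 * (i.1 + 1) : ℕ) * riemannZeta (2 * (i.2 + 1) : ℕ)) := by
    rw [mul_sum]
    refine sum_congr rfl fun i _ ↦ ?_
    rw [hpow, neg_pow (τ ^ 2)]
    ring
  rw [ramanujanPolynomial_natCast, Nat.sum_antidiagonal_succ, Nat.sum_antidiagonal_succ']
  simp only [hinterior, Nat.mul_zero, Nat.cast_zero, riemannZeta_zero]
  rw [hpow, neg_pow (τ ^ 2), mul_zero, zero_sub, zpow_neg_one]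
  ring

theorem cothSeries_add_ramanujanPolynomial_of_pos {k : ℕ} (hk : 0 < k) {τ : ℂ} (hτ : 0 < τ.re) :
    cothSeries (2 * k + 1) τ + ramanujanPolynomial k τ =
      (-1) ^ k * τ ^ (2 * k) * cothSeries (2 * k + 1) τ⁻¹ := by
  obtain ⟨m, rfl⟩ := Nat.exists_eq_add_of_le' hk
  have hτ0 : τ ≠ 0 := ne_zero_of_re_pos hτ
  have hm : 1 < 2 * (m + 1) := by omega
  have hr : (2 * ((m + 1 : ℕ) : ℤ) + 1) = (2 * (m + 1) + 1 : ℕ) := by push_cast; ring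
  have hζ : 2 * (m + 2) = 2 * (m + 1) + 2 := by ring
  rw [hr, cothSeries_eq_tsum_latticeTerm hm hτ, cothSeries_eq_tsum_latticeTerm hm (inv_re_pos hτ),
    ramanujanPolynomial_natCast_succ, ← tsum_latticeTerm_add_tsum_latticeTerm_inv m hτ, hζ,
    inv_inv, neg_pow (τ ^ 2)]
  generalize ∑' p, latticeTerm (2 * (m + 1)) τ p = T
  generalize ∑' p, latticeTerm (2 * (m + 1)) τ⁻¹ p = T'
  field_simp
  ring

theorem cothSeries_add_ramanujanPolynomial_of_neg {n : ℕ} (hn : 0 < n) {τ : ℂ} (hτ : 0 < τ.re) :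
    cothSeries (2 * -n + 1) τ + ramanujanPolynomial (-n) τ =
      (-1) ^ (-n : ℤ) * τ ^ (2 * -n : ℤ) * cothSeries (2 * -n + 1) τ⁻¹ := by
  have hτ0 : τ ≠ 0 := ne_zero_of_re_pos hτ
  obtain rfl | hn : n = 1 ∨ 1 < n := by omega
  · have hr : (2 * -1 + 1 : ℤ) = -1 := by norm_num
    have hpow : τ ^ (2 * -1 : ℤ) = (τ ^ 2)⁻¹ := by norm_cast
    have hπ : (π : ℂ) ≠ 0 := by simp
    rw [Nat.cast_one, hr, ramanujanPolynomial_neg_one, cothSeries_neg_one_inv hτ, hpow]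
    field_simp
    ring
  · have hr : 2 * -n + 1 = -((2 * n - 1 : ℕ) : ℤ) := by omega
    have hweight : (I * τ) ^ (2 * n - 1 + 1) = (-1) ^ n * τ ^ (2 * n) := by
      rw [Nat.sub_add_cancel (by omega), mul_pow, pow_mul I, I_sq]
    have hsign : (-1 : ℂ) ^ (-n : ℤ) * (-1) ^ n = 1 := by
      rw [← zpow_natCast, ← zpow_add₀ (by norm_num), neg_add_cancel, zpow_zero]
    have hpow : τ ^ (2 * -n : ℤ) * τ ^ (2 * n) = 1 := by
      rw [← zpow_natCast, ← zpow_add₀ hτ0, Nat.cast_mul, Nat.cast_two, mul_neg, neg_add_cancel,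
        zpow_zero]
    rw [ramanujanPolynomial_of_lt_neg_one (by omega), hr,
      cothSeries_neg_natCast_inv hτ (by omega) ⟨n, by omega⟩, hweight]
    linear_combination
      (-(-1) ^ (-n : ℤ) * (-1) ^ n * hpow - hsign) * cothSeries (-(2 * n - 1 : ℕ)) τ

theorem cothSeries_add_ramanujanPolynomial {k : ℤ} (hk : k ≠ 0) {τ : ℂ} (hτ : 0 < τ.re) :
    cothSeries (2 * k + 1) τ + ramanujanPolynomial k τ =
      (-1) ^ k * τ ^ (2 * k) * cothSeries (2 * k + 1) τ⁻¹ := by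
  rcases k.eq_nat_or_neg with ⟨n, rfl | rfl⟩
  · exact_mod_cast cothSeries_add_ramanujanPolynomial_of_pos (by omega) hτ
  · exact cothSeries_add_ramanujanPolynomial_of_neg (by omega) hτ

end Ramanujan

theorem corollary4p5 :
    -- Euler's formula
    (∀ k : ℕ, 1 ≤ k →
      riemannZeta (2 * (k : ℂ)) =
        (-1 : ℂ) ^ (k + 1) * (2 * (Real.pi : ℂ)) ^ (2 * k) / (2 * ((2 * k).factorial : ℂ))
          * (bernoulli (2 * k) : ℂ)) ∧
    -- Ramanujan's formula; the sum over `j` runs over `0 ≤ j ≤ k + 1`, and is empty if `k < -1`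
    (∀ k : ℤ, k ≠ 0 → ∀ τ : ℂ, τ ≠ 0 → |τ.arg| < Real.pi / 2 →
      ∀ q q' : ℂ, q = Complex.exp (-2 * (Real.pi : ℂ) * τ) →
        q' = Complex.exp (-2 * (Real.pi : ℂ) / τ) →
      Summable (qSeriesTerm (2 * k + 1) q) ∧
      Summable (qSeriesTerm (2 * k + 1) q') ∧
      riemannZeta (2 * (k : ℂ) + 1) + 2 * qSeries (2 * k + 1) q
          + (2 * (Real.pi : ℂ)) ^ (2 * k + 1)
            * ∑ j ∈ Finset.Icc (0 : ℤ) (k + 1),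
                (-1 : ℂ) ^ j
                  * (bernoulli (2 * j).toNat : ℂ) * (bernoulli (2 * k + 2 - 2 * j).toNat : ℂ)
                  / (((2 * j).toNat.factorial : ℂ) * ((2 * k + 2 - 2 * j).toNat.factorial : ℂ))
                  * τ ^ (2 * k + 1 - 2 * j)
        = (-1 : ℂ) ^ k * τ ^ (2 * k)
            * (riemannZeta (2 * (k : ℂ) + 1) + 2 * qSeries (2 * k + 1) q')) := by
  refine ⟨fun k _ ↦ riemannZeta_two_mul_natCast k, ?_⟩
  rintro k hk τ hτ0 harg _ _ rfl rfl
  have hτ : 0 < τ.re := (abs_arg_lt_pi_div_two_iff.mp harg).resolve_right hτ0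
  have hcoth (z : ℂ) : cothSeries (2 * k + 1) z =
      riemannZeta (2 * k + 1) + 2 * qSeries (2 * k + 1) (cexp (-2 * π * z)) := by
    rw [cothSeries]
    push_cast
    rfl
  rw [div_eq_mul_inv, ← hcoth, ← hcoth]
  exact ⟨summable_qSeriesTerm _ (norm_exp_neg_two_pi_mul_lt_one hτ),
    summable_qSeriesTerm _ (norm_exp_neg_two_pi_mul_lt_one (inv_re_pos hτ)),
    cothSeries_add_ramanujanPolynomial hk hτ⟩
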